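/- Let $\mathbb{D}$ be the open unit disc, $dA$ the normalized area measure on $\mathbb{D}$, and let $B_1$ be the analytic Besov (minimal Möbius invariant) space of all analytic functions $f$ on $\mathbb{D}$ with $$\|f\|_{B_1}=|f(0)|+|f'(0)|+\int_{\mathbb{D}}|f''(z)|\,dA(z)<\infty ,$$ equipped with this norm. Let $g$ be analytic on $\mathbb{D}$ and let $T_g$ be the Volterra type operator $$(T_gf)(z)=\int_0^z f(w)\,g'(w)\,dw ,\qquad f\in B_1,\ z\in\mathbb{D}.$$ If $T_g$ is a bounded operator on $B_1$ (that is, it maps $B_1$ into $B_1$ and is bounded in the above norm), then its spectrum as a bounded operator on $B_1$ is $\sigma(T_g)=\{0\}$. -/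

import Mathlib

open MeasureTheory Metric

/-- The open unit disc of the complex plane. -/
abbrev unitDisc : Set ℂ := ball (0 : ℂ) 1

/-- Normalized area measure on the unit disc, `dA = π⁻¹ dx dy`. -/
noncomputable def areaMeasure : Measure ℂ :=
  ENNReal.ofReal (Real.pi⁻¹) • (volume.restrict unitDisc)

theorem ae_areaMeasure_mem : ∀ᵐ z ∂areaMeasure, z ∈ unitDisc :=
  Measure.ae_smul_measure (ae_restrict_mem measurableSet_ball) _

theorem deriv_eqOn_add {f h : ℂ → ℂ} (hf : DifferentiableOn ℂ f unitDisc)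
    (hh : DifferentiableOn ℂ h unitDisc) :
    Set.EqOn (deriv (f + h)) (deriv f + deriv h) unitDisc := fun _ hz =>
  deriv_add (hf.differentiableAt (isOpen_ball.mem_nhds hz))
    (hh.differentiableAt (isOpen_ball.mem_nhds hz))

theorem deriv_deriv_eqOn_add {f h : ℂ → ℂ} (hf : DifferentiableOn ℂ f unitDisc)
    (hh : DifferentiableOn ℂ h unitDisc) :
    Set.EqOn (deriv (deriv (f + h))) (deriv (deriv f) + deriv (deriv h)) unitDisc := by
  intro z hz
  rw [((deriv_eqOn_add hf hh).eventuallyEq_of_mem (isOpen_ball.mem_nhds hz)).deriv_eq]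
  exact deriv_eqOn_add (hf.deriv isOpen_ball) (hh.deriv isOpen_ball) hz

theorem deriv_deriv_const_smul (c : ℂ) (f : ℂ → ℂ) :
    deriv (deriv (c • f)) = c • deriv (deriv f) := by
  have key : ∀ u : ℂ → ℂ, deriv (c • u) = c • deriv u := fun u => by
    funext z
    rw [deriv_const_smul_field, Pi.smul_apply]
  rw [key, key]

/-- The analytic Besov space as a complex vector space. An analytic function on the disc is
represented by its extension by zero to the plane, so that equality of elements is equality of
functions on the disc. Since the disc is open, derivatives at its points only see values there. -/
noncomputable def besovSubmodule : Submodule ℂ (ℂ → ℂ) where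
  carrier := {f | DifferentiableOn ℂ f unitDisc ∧ (∀ z, z ∉ unitDisc → f z = 0) ∧
    Integrable (deriv (deriv f)) areaMeasure}
  zero_mem' := by
    refine ⟨differentiableOn_const (0 : ℂ), fun _ _ => rfl, ?_⟩
    have h : deriv (deriv (0 : ℂ → ℂ)) = 0 := by simpa only [zero_smul] using deriv_deriv_const_smul 0 0
    rw [h]
    exact integrable_zero _ _ _
  add_mem' := by
    rintro f h ⟨hf, hf0, hfi⟩ ⟨hh, hh0, hhi⟩
    refine ⟨hf.add hh, fun z hz => by simp [hf0 z hz, hh0 z hz], ?_⟩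
    refine (hfi.add hhi).congr ?_
    filter_upwards [ae_areaMeasure_mem] with z hz
    exact (deriv_deriv_eqOn_add hf hh hz).symm
  smul_mem' := by
    rintro c f ⟨hf, hf0, hfi⟩
    refine ⟨hf.const_smul c, fun z hz => by simp [hf0 z hz], ?_⟩
    rw [deriv_deriv_const_smul]
    exact hfi.smul c

/-- The analytic Besov space `B₁`, i.e. the analytic functions `f` on the disc with
`∫ |f''| dA < ∞`. This is a separate type, so that its topology is that of the norm below. -/
def BesovB1 : Type := besovSubmodule

namespace BesovB1

noncomputable instance : AddCommGroup BesovB1 := inferInstanceAs (AddCommGroup besovSubmodule)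

noncomputable instance : Module ℂ BesovB1 := inferInstanceAs (Module ℂ besovSubmodule)

/-- The underlying function (extended by zero off the disc). -/
def toFun (f : BesovB1) : ℂ → ℂ := Subtype.val f

instance : CoeFun BesovB1 (fun _ => ℂ → ℂ) := ⟨toFun⟩

/-- The norm `‖f‖ = |f(0)| + |f'(0)| + ∫ |f''| dA`. -/
noncomputable instance : Norm BesovB1 :=
  ⟨fun f => ‖f 0‖ + ‖deriv f 0‖ + ∫ z, ‖deriv (deriv f) z‖ ∂areaMeasure⟩

theorem norm_def (f : BesovB1) :
    ‖f‖ = ‖f 0‖ + ‖deriv f 0‖ + ∫ z, ‖deriv (deriv f) z‖ ∂areaMeasure := rfl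

theorem coe_add (f h : BesovB1) : toFun (f + h) = toFun f + toFun h := rfl

theorem coe_smul (c : ℂ) (f : BesovB1) : toFun (c • f) = c • toFun f := rfl

theorem differentiableOn (f : BesovB1) : DifferentiableOn ℂ f unitDisc := f.2.1

theorem eq_zero_off (f : BesovB1) {z : ℂ} (hz : z ∉ unitDisc) : f z = 0 := f.2.2.1 z hz

theorem integrable (f : BesovB1) : Integrable (deriv (deriv f)) areaMeasure := f.2.2.2

theorem eq_zero_of_norm_eq_zero (f : BesovB1) (hf : ‖f‖ = 0) : f = 0 := by
  have hI : 0 ≤ ∫ z, ‖deriv (deriv f) z‖ ∂areaMeasure :=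
    integral_nonneg fun z => norm_nonneg _
  have h0 := norm_nonneg (f 0)
  have h1 := norm_nonneg (deriv f 0)
  rw [norm_def] at hf
  have hf0 : f 0 = 0 := norm_eq_zero.1 (by linarith)
  have hf1 : deriv f 0 = 0 := norm_eq_zero.1 (by linarith)
  have hf2 : ∫ z, ‖deriv (deriv f) z‖ ∂areaMeasure = 0 := by linarith
  rw [integral_eq_zero_iff_of_nonneg (fun z => norm_nonneg _) f.integrable.norm] at hf2
  have hae : deriv (deriv f) =ᵐ[volume.restrict unitDisc] (fun _ => (0 : ℂ)) := by
    have hpi : ENNReal.ofReal (Real.pi⁻¹) ≠ 0 := by simp [Real.pi_pos]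
    have h2 : ∀ᵐ z ∂(volume.restrict unitDisc), ‖deriv (deriv f) z‖ = 0 := by
      have := hf2
      rw [areaMeasure, Filter.EventuallyEq, Measure.ae_ennreal_smul_measure_iff hpi] at this
      exact this
    filter_upwards [h2] with z hz using norm_eq_zero.1 hz
  have hd : DifferentiableOn ℂ (deriv f) unitDisc := f.differentiableOn.deriv isOpen_ball
  have hz2 : Set.EqOn (deriv (deriv f)) (fun _ => (0 : ℂ)) unitDisc :=
    Measure.eqOn_open_of_ae_eq hae isOpen_ball (hd.deriv isOpen_ball).continuousOn
      continuousOn_const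
  have hpc : IsPreconnected unitDisc := (convex_ball (0 : ℂ) 1).isPreconnected
  have hm : (0 : ℂ) ∈ unitDisc := by simp
  have hz1 : Set.EqOn (deriv f) (fun _ => (0 : ℂ)) unitDisc := fun z hz =>
    (isOpen_ball.is_const_of_deriv_eq_zero hpc hd hz2 hz hm).trans hf1
  refine Subtype.ext (funext fun z => ?_)
  by_cases hz : z ∈ unitDisc
  · exact (isOpen_ball.is_const_of_deriv_eq_zero hpc f.differentiableOn hz1 hz hm).trans hf0
  · exact f.eq_zero_off hz

theorem core : NormedSpace.Core ℂ BesovB1 where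
  norm_nonneg f := by
    rw [norm_def]
    have : 0 ≤ ∫ z, ‖deriv (deriv f) z‖ ∂areaMeasure := integral_nonneg fun z => norm_nonneg _
    positivity
  norm_smul c f := by
    have h1 : deriv (c • toFun f) 0 = c * deriv f 0 := by
      rw [deriv_const_smul_field, smul_eq_mul]
    simp only [norm_def, coe_smul, deriv_deriv_const_smul, h1, Pi.smul_apply, smul_eq_mul,
      norm_mul, integral_const_mul]
    ring
  norm_triangle f h := by
    have hm : (0 : ℂ) ∈ unitDisc := by simp
    have e1 := deriv_eqOn_add f.differentiableOn h.differentiableOn hm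
    have e2 : ∫ z, ‖deriv (deriv (toFun f + toFun h)) z‖ ∂areaMeasure ≤
        ∫ z, ‖deriv (deriv f) z‖ ∂areaMeasure + ∫ z, ‖deriv (deriv h) z‖ ∂areaMeasure := by
      rw [← integral_add f.integrable.norm h.integrable.norm]
      refine integral_mono_ae (f + h).integrable.norm
        (f.integrable.norm.add h.integrable.norm) ?_
      filter_upwards [ae_areaMeasure_mem] with z hz
      have e3 := deriv_deriv_eqOn_add f.differentiableOn h.differentiableOn hz
      simp only [e3]
      exact norm_add_le _ _
    have e4 := norm_add_le (f 0) (h 0)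
    have e5 := norm_add_le (deriv f 0) (deriv h 0)
    simp only [norm_def, coe_add, e1, Pi.add_apply]
    linarith
  norm_eq_zero_iff f := by
    refine ⟨eq_zero_of_norm_eq_zero f, ?_⟩
    rintro rfl
    have hz : toFun (0 : BesovB1) = (0 : ℂ) • toFun (0 : BesovB1) := by
      rw [← coe_smul, zero_smul]
    rw [norm_def, hz, deriv_deriv_const_smul]
    simp

noncomputable instance : NormedAddCommGroup BesovB1 := NormedAddCommGroup.ofCore core

noncomputable instance : NormedSpace ℂ BesovB1 := NormedSpace.ofCore core

end BesovB1

/-- The Volterra type transform `(T_g f)(z) = ∫₀ᶻ f(w) g'(w) dw`, where the complex line integral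
is taken along the segment from `0` to `z`, parametrized by `w = t z`, `0 ≤ t ≤ 1`. -/
noncomputable def volterra (g f : ℂ → ℂ) (z : ℂ) : ℂ :=
  ∫ t in (0 : ℝ)..1, f (t * z) * deriv g (t * z) * z

/-- The bounded operator `T` on `B₁` is the Volterra type operator `T_g`. Thus `T_g` is bounded
on `B₁` exactly when there is such a `T`, which is then unique. -/
def IsVolterraOperator (g : ℂ → ℂ) (T : BesovB1 →L[ℂ] BesovB1) : Prop :=
  ∀ f : BesovB1, ∀ z ∈ unitDisc, T f z = volterra g f z

/-! Formally, `l f - T_g f = h` is a first-order linear ODE with integrating factor `exp (-g / l)`.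
Solving it and integrating by parts gives the resolvent `l⁻¹ + l⁻² exp (g / l) T_g exp (-g / l)` for
`l ≠ 0`. It remains to see that multiplication by `exp (c g)` is bounded on `B₁`.

This rests on the embedding of `B₁` in the bounded analytic functions (`BesovB1.norm_apply_le`).
Since `T_g 1 = g - g(0)` lies in `B₁`, `g` is bounded and `g''` is integrable. As `(T_g f)'' = f' g'
+ f g''`, the map `f ↦ f' g'` is bounded into `L¹`; taking `f = T_g 1` shows that `g'²` is
integrable. These facts control every term of `(exp (c g) f)''` (`cexp_mul_estimate`).

Finally `0` is in the spectrum because every `T_g f` vanishes at the origin, so `T_g` is not onto.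
-/

/-! ### Embedding of `B₁` in the bounded analytic functions. -/

theorem sq_mul_mem_unitDisc {z : ℂ} (hz : z ∈ unitDisc) {r : ℝ} (hr : r ∈ Set.Icc (0 : ℝ) 1) :
    ((r : ℂ) ^ 2 * z) ∈ unitDisc := by
  rw [mem_ball_zero_iff] at hz ⊢
  rw [norm_mul, norm_pow, Complex.norm_real, Real.norm_of_nonneg hr.1]
  have : r ^ 2 ≤ 1 := pow_le_one₀ hr.1 hr.2
  nlinarith [norm_nonneg z]

/-- Cauchy's formula on the circle of radius `r`, at the point `r² z`. -/
theorem norm_le_integral_circleMap {F : ℂ → ℂ} (hF : DifferentiableOn ℂ F unitDisc) {z : ℂ}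
    (hz : z ∈ unitDisc) {r : ℝ} (hr : r ∈ Set.Ioo (0 : ℝ) 1) :
    2 * Real.pi * ((1 - r) * ‖F ((r : ℂ) ^ 2 * z)‖) ≤
      ∫ θ in (0 : ℝ)..2 * Real.pi, ‖F (circleMap 0 r θ)‖ := by
  obtain ⟨hr0, hr1⟩ := hr
  have hz1 : ‖z‖ < 1 := mem_ball_zero_iff.1 hz
  -- The factor `r²` keeps `w` at distance at least `r (1 - r)` from the circle of radius `r`,
  -- uniformly in `z`. The arc length factor `r` then leaves the Cauchy kernel bounded by `(1 -
  -- r)⁻¹`.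
  set w : ℂ := (r : ℂ) ^ 2 * z with hw
  have hwn : ‖w‖ ≤ r ^ 2 := by
    rw [hw, norm_mul, norm_pow, Complex.norm_real, Real.norm_of_nonneg hr0.le]
    nlinarith [sq_nonneg r]
  have hwr : r - r ^ 2 > 0 := by nlinarith
  have hwb : w ∈ ball (0 : ℂ) r := by
    rw [mem_ball_zero_iff]; linarith
  have hsub : closedBall (0 : ℂ) r ⊆ unitDisc := closedBall_subset_ball hr1
  have hC := Complex.circleIntegral_sub_inv_smul_of_differentiable_on_off_countable
    (f := F) Set.countable_empty hwb (hF.continuousOn.mono hsub)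
    (fun x hx => hF.differentiableAt (isOpen_ball.mem_nhds (hsub (ball_subset_closedBall hx.1))))
  have hcm : ∀ θ : ℝ, circleMap 0 r θ ∈ unitDisc := fun θ =>
    hsub (circleMap_mem_closedBall 0 hr0.le θ)
  have hcont : Continuous fun θ : ℝ => ‖F (circleMap 0 r θ)‖ :=
    (hF.continuousOn.comp_continuous (continuous_circleMap 0 r) hcm).norm
  have hle : ‖∮ u in C(0, r), (u - w)⁻¹ • F u‖ ≤
      ∫ θ in (0 : ℝ)..2 * Real.pi, (1 - r)⁻¹ * ‖F (circleMap 0 r θ)‖ := by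
    rw [circleIntegral]
    refine intervalIntegral.norm_integral_le_of_norm_le Real.two_pi_pos.le ?_
      ((hcont.const_mul _).intervalIntegrable _ _)
    refine Filter.Eventually.of_forall fun θ _ => ?_
    have h1 : ‖circleMap 0 r θ‖ = r := by
      rw [norm_circleMap_zero, abs_of_pos hr0]
    have h2 : r - r ^ 2 ≤ ‖circleMap 0 r θ - w‖ := by
      have := norm_sub_norm_le (circleMap 0 r θ) w
      linarith
    rw [deriv_circleMap, norm_smul, norm_smul, norm_mul, Complex.norm_I, mul_one, h1, norm_inv,
      ← mul_assoc]
    refine mul_le_mul_of_nonneg_right ?_ (norm_nonneg _)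
    calc r * ‖circleMap 0 r θ - w‖⁻¹ ≤ r * (r - r ^ 2)⁻¹ := by gcongr
      _ = (1 - r)⁻¹ := by
        have : 1 - r ≠ 0 := by linarith
        have h3 : r - r ^ 2 = r * (1 - r) := by ring
        rw [h3]; field_simp
  rw [hC, norm_smul, intervalIntegral.integral_const_mul] at hle
  have hpi : ‖(2 * Real.pi * Complex.I : ℂ)‖ = 2 * Real.pi := by
    simp [abs_of_pos Real.pi_pos]
  rw [hpi] at hle
  have h1r : 0 < 1 - r := by linarith
  calc 2 * Real.pi * ((1 - r) * ‖F w‖) = (1 - r) * (2 * Real.pi * ‖F w‖) := by ring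
    _ ≤ (1 - r) * ((1 - r)⁻¹ * ∫ θ in (0 : ℝ)..2 * Real.pi, ‖F (circleMap 0 r θ)‖) := by gcongr
    _ = _ := by rw [← mul_assoc, mul_inv_cancel₀ h1r.ne', one_mul]

/-- Multiplying the bound on each circle by the Jacobian `r` and integrating in `r` turns the circle
means into an area integral, by polar coordinates. -/
theorem lintegral_radial_le {F : ℂ → ℂ} (hF : DifferentiableOn ℂ F unitDisc) (hFm : Measurable F)
    {z : ℂ} (hz : z ∈ unitDisc) :
    ∫⁻ r in Set.Ioo (0 : ℝ) 1, ENNReal.ofReal (2 * Real.pi * (r * (1 - r) * ‖F ((r : ℂ) ^ 2 * z)‖)) ≤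
      ∫⁻ w in unitDisc, ‖F w‖ₑ := by
  have hsymm : ∀ p : ℝ × ℝ, Complex.polarCoord.symm p = circleMap 0 p.1 p.2 := fun p => by
    rw [Complex.polarCoord_symm_apply, circleMap_zero, Complex.exp_mul_I]
    push_cast; ring
  have hmeas : Measurable (unitDisc.indicator fun w => ‖F w‖ₑ) :=
    hFm.enorm.indicator measurableSet_ball
  have hcirc : Measurable fun p : ℝ × ℝ => circleMap 0 p.1 p.2 := by
    unfold circleMap; fun_prop
  rw [← lintegral_indicator measurableSet_ball, ← Complex.lintegral_comp_polarCoord_symm]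
  simp_rw [hsymm]
  rw [polarCoord_target, Measure.volume_eq_prod, ← Measure.prod_restrict, lintegral_prod]
  swap
  · refine Measurable.aemeasurable ?_
    simp only [smul_eq_mul]
    exact (ENNReal.measurable_ofReal.comp measurable_fst).mul (hmeas.comp hcirc)
  refine le_trans ?_ (lintegral_mono_set (s := Set.Ioo (0 : ℝ) 1) Set.Ioo_subset_Ioi_self)
  refine setLIntegral_mono' measurableSet_Ioo fun r hr => ?_
  have hcm : ∀ θ : ℝ, circleMap 0 r θ ∈ unitDisc := fun θ =>
    closedBall_subset_ball hr.2 (circleMap_mem_closedBall 0 hr.1.le θ)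
  have hcont : Continuous fun θ : ℝ => ‖F (circleMap 0 r θ)‖ :=
    (hF.continuousOn.comp_continuous (continuous_circleMap 0 r) hcm).norm
  -- Circle integrals run over `(0, 2π)`, polar coordinates over `(-π, π)`; periodicity matches
  -- them.
  have hper : ∫ θ in (0 : ℝ)..2 * Real.pi, ‖F (circleMap 0 r θ)‖ =
      ∫ θ in (-Real.pi)..Real.pi, ‖F (circleMap 0 r θ)‖ := by
    have hp : Function.Periodic (fun θ : ℝ => ‖F (circleMap 0 r θ)‖) (2 * Real.pi) := fun θ => by
      simp only [periodic_circleMap 0 r θ]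
    have := hp.intervalIntegral_add_eq 0 (-Real.pi)
    rw [zero_add] at this
    rw [this]; congr 1; ring
  have hC := norm_le_integral_circleMap hF hz hr
  rw [hper, intervalIntegral.integral_of_le (by linarith [Real.pi_pos]),
    integral_Ioc_eq_integral_Ioo] at hC
  have hint : Integrable (fun θ : ℝ => ‖F (circleMap 0 r θ)‖)
      (volume.restrict (Set.Ioo (-Real.pi) Real.pi)) :=
    (hcont.integrableOn_Icc).mono_set Set.Ioo_subset_Icc_self
  calc ENNReal.ofReal (2 * Real.pi * (r * (1 - r) * ‖F ((r : ℂ) ^ 2 * z)‖))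
      = ENNReal.ofReal r * ENNReal.ofReal (2 * Real.pi * ((1 - r) * ‖F ((r : ℂ) ^ 2 * z)‖)) := by
        rw [← ENNReal.ofReal_mul hr.1.le]; congr 1; ring
    _ ≤ ENNReal.ofReal r * ENNReal.ofReal
          (∫ θ in Set.Ioo (-Real.pi) Real.pi, ‖F (circleMap 0 r θ)‖) := by gcongr
    _ = ENNReal.ofReal r * ∫⁻ θ in Set.Ioo (-Real.pi) Real.pi, ‖F (circleMap 0 r θ)‖ₑ := by
        rw [ofReal_integral_eq_lintegral_ofReal hint (Filter.Eventually.of_forall fun _ =>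
          norm_nonneg _)]
        simp only [ofReal_norm]
    _ = ∫⁻ θ in Set.Ioo (-Real.pi) Real.pi, ENNReal.ofReal r • 
          unitDisc.indicator (fun w => ‖F w‖ₑ) (circleMap 0 r θ) := by
        simp only [smul_eq_mul, Set.indicator_of_mem (hcm _)]
        rw [lintegral_const_mul' _ _ ENNReal.ofReal_ne_top]
    _ ≤ _ := le_rfl

theorem integral_areaMeasure (h : ℂ → ℝ) :
    ∫ z, h z ∂areaMeasure = Real.pi⁻¹ * ∫ z in unitDisc, h z := by
  rw [areaMeasure, integral_smul_measure, ENNReal.toReal_ofReal (inv_nonneg.2 Real.pi_pos.le),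
    smul_eq_mul]

theorem integrable_areaMeasure {h : ℂ → ℂ} :
    Integrable h areaMeasure ↔ IntegrableOn h unitDisc := by
  rw [areaMeasure, integrable_smul_measure (by simp [Real.pi_pos]) ENNReal.ofReal_ne_top]
  rfl

theorem continuousOn_comp_sq_mul {F : ℂ → ℂ} (hF : DifferentiableOn ℂ F unitDisc) {z : ℂ}
    (hz : z ∈ unitDisc) :
    ContinuousOn (fun r : ℝ => F ((r : ℂ) ^ 2 * z)) (Set.Icc 0 1) :=
  hF.continuousOn.comp (by fun_prop) fun _ hr => sq_mul_mem_unitDisc hz hr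

theorem integral_radial_le {F : ℂ → ℂ} (hF : DifferentiableOn ℂ F unitDisc) (hFm : Measurable F)
    (hFi : Integrable F areaMeasure) {z : ℂ} (hz : z ∈ unitDisc) :
    ∫ r in (0 : ℝ)..1, 2 * (r * (1 - r) * ‖F ((r : ℂ) ^ 2 * z)‖) ≤ ∫ w, ‖F w‖ ∂areaMeasure := by
  have hcont : ContinuousOn (fun r : ℝ => 2 * Real.pi * (r * (1 - r) * ‖F ((r : ℂ) ^ 2 * z)‖))
      (Set.Icc 0 1) := by
    have := (continuousOn_comp_sq_mul hF hz).norm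
    fun_prop
  have hint : Integrable (fun r : ℝ => 2 * Real.pi * (r * (1 - r) * ‖F ((r : ℂ) ^ 2 * z)‖))
      (volume.restrict (Set.Ioo 0 1)) :=
    hcont.integrableOn_Icc.mono_set Set.Ioo_subset_Icc_self
  have hle := lintegral_radial_le hF hFm hz
  have hnn : 0 ≤ᵐ[volume.restrict (Set.Ioo (0 : ℝ) 1)]
      fun r : ℝ => 2 * Real.pi * (r * (1 - r) * ‖F ((r : ℂ) ^ 2 * z)‖) := by
    filter_upwards [ae_restrict_mem measurableSet_Ioo] with r hr
    have h0 := hr.1.le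
    have h1 : 0 ≤ 1 - r := by linarith [hr.2]
    have := Real.pi_pos.le
    simp only [Pi.zero_apply]
    positivity
  rw [← ofReal_integral_eq_lintegral_ofReal hint hnn,
    ← ofReal_integral_norm_eq_lintegral_enorm (integrable_areaMeasure.1 hFi),
    ENNReal.ofReal_le_ofReal_iff (integral_nonneg fun _ => norm_nonneg _)] at hle
  rw [integral_areaMeasure, intervalIntegral.integral_of_le zero_le_one,
    integral_Ioc_eq_integral_Ioo, le_inv_mul_iff₀ Real.pi_pos, ← integral_const_mul]
  refine le_trans (le_of_eq ?_) hle
  congr 1; ext r; ring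

/-- Taylor's formula with integral remainder `∫ (1 - s) z² f''(s z) ds`, after substituting `s = r²`
to meet the points `r² z` of the radial estimate. -/
theorem taylor_integral_radial {f : ℂ → ℂ} (hf : DifferentiableOn ℂ f unitDisc) {z : ℂ}
    (hz : z ∈ unitDisc) :
    ∫ r in (0 : ℝ)..1, 2 * (r : ℂ) * (1 - (r : ℂ) ^ 2) * z ^ 2 * deriv (deriv f) ((r : ℂ) ^ 2 * z) =
      f z - f 0 - z * deriv f 0 := by
  have hd := hf.deriv isOpen_ball
  have hdd := hd.deriv isOpen_ball
  have key := intervalIntegral.integral_eq_sub_of_hasDerivAt (a := 0) (b := 1)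
    (f := fun r : ℝ => f ((r : ℂ) ^ 2 * z) + (1 - (r : ℂ) ^ 2) * z * deriv f ((r : ℂ) ^ 2 * z))
    (f' := fun r : ℝ =>
      2 * (r : ℂ) * (1 - (r : ℂ) ^ 2) * z ^ 2 * deriv (deriv f) ((r : ℂ) ^ 2 * z)) ?_ ?_
  · rw [key]; simp; ring
  · intro r hr
    rw [Set.uIcc_of_le zero_le_one] at hr
    have hm := isOpen_ball.mem_nhds (sq_mul_mem_unitDisc hz hr)
    have hsq : HasDerivAt (fun r : ℝ => (r : ℂ) ^ 2) (2 * (r : ℂ)) r := by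
      simpa using (hasDerivAt_pow 2 (r : ℂ)).comp_ofReal
    have hp := hsq.mul_const z
    have h1 := (hf.differentiableAt hm).hasDerivAt.comp r hp
    have h2 := (hd.differentiableAt hm).hasDerivAt.comp r hp
    refine (h1.add (((hsq.const_sub 1).mul_const z).mul h2)).congr_deriv ?_
    simp only [Function.comp]
    ring
  · refine ContinuousOn.intervalIntegrable ?_
    rw [Set.uIcc_of_le zero_le_one]
    have := continuousOn_comp_sq_mul hdd hz
    fun_prop

namespace BesovB1

theorem norm_apply_zero_le (f : BesovB1) : ‖f 0‖ ≤ ‖f‖ := by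
  have : 0 ≤ ∫ z, ‖deriv (deriv f) z‖ ∂areaMeasure := integral_nonneg fun z => norm_nonneg _
  rw [norm_def]; linarith [norm_nonneg (deriv f 0)]

theorem norm_deriv_zero_le (f : BesovB1) : ‖deriv f 0‖ ≤ ‖f‖ := by
  have : 0 ≤ ∫ z, ‖deriv (deriv f) z‖ ∂areaMeasure := integral_nonneg fun z => norm_nonneg _
  rw [norm_def]; linarith [norm_nonneg (f 0)]

theorem integral_norm_deriv_deriv_le (f : BesovB1) :
    ∫ z, ‖deriv (deriv f) z‖ ∂areaMeasure ≤ ‖f‖ := by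
  rw [norm_def]; linarith [norm_nonneg (f 0), norm_nonneg (deriv f 0)]

/-- `B₁` embeds boundedly in the bounded analytic functions. -/
theorem norm_apply_le (f : BesovB1) {z : ℂ} (hz : z ∈ unitDisc) : ‖f z‖ ≤ 2 * ‖f‖ := by
  have hd := (f.differentiableOn.deriv isOpen_ball).deriv isOpen_ball
  have hz1 : ‖z‖ < 1 := mem_ball_zero_iff.1 hz
  have hI := integral_radial_le hd (measurable_deriv _) f.integrable hz
  have hT : ‖f z - f 0 - z * deriv f 0‖ ≤ 2 * ∫ w, ‖deriv (deriv f) w‖ ∂areaMeasure := by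
    rw [← taylor_integral_radial f.differentiableOn hz]
    refine le_trans ?_ (mul_le_mul_of_nonneg_left hI zero_le_two)
    rw [← intervalIntegral.integral_const_mul]
    refine intervalIntegral.norm_integral_le_of_norm_le zero_le_one ?_ ?_
    · refine Filter.Eventually.of_forall fun r hr => ?_
      have h0 : 0 ≤ r := hr.1.le
      have h1 : 0 ≤ 1 - r := by linarith [hr.2]
      have e : ‖(1 - (r : ℂ) ^ 2)‖ = 1 - r ^ 2 := by
        rw [← Complex.ofReal_one, ← Complex.ofReal_pow, ← Complex.ofReal_sub, Complex.norm_real,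
          Real.norm_of_nonneg (by nlinarith)]
      rw [norm_mul, norm_mul, norm_mul, norm_mul, e, Complex.norm_real, Real.norm_of_nonneg h0,
        norm_pow, Complex.norm_ofNat]
      have h2 : ‖z‖ ^ 2 ≤ 1 := pow_le_one₀ (norm_nonneg z) hz1.le
      -- Here `1 - r² = (1 + r)(1 - r) ≤ 2 (1 - r)`, so the Taylor weight is at most twice the
      -- weight in `integral_radial_le`. This is the source of the constant `2` in the embedding.
      have h3 : 2 * r * (1 - r ^ 2) * ‖z‖ ^ 2 ≤ 2 * (2 * (r * (1 - r))) := by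
        have h4 : 0 ≤ r * (1 - r) := mul_nonneg h0 h1
        calc 2 * r * (1 - r ^ 2) * ‖z‖ ^ 2 ≤ 2 * r * (1 - r ^ 2) * 1 := by
              refine mul_le_mul_of_nonneg_left h2 ?_
              have : 0 ≤ 1 - r ^ 2 := by nlinarith
              positivity
          _ ≤ _ := by nlinarith [hr.2]
      calc _ ≤ 2 * (2 * (r * (1 - r))) * ‖deriv (deriv f) ((r : ℂ) ^ 2 * z)‖ := by gcongr
        _ = _ := by ring
    · refine ContinuousOn.intervalIntegrable ?_
      rw [Set.uIcc_of_le zero_le_one]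
      have := (continuousOn_comp_sq_mul hd hz).norm
      fun_prop
  have h5 : ‖z * deriv f 0‖ ≤ ‖deriv f 0‖ := by
    rw [norm_mul]; nlinarith [norm_nonneg (deriv f 0)]
  have h6 : ‖f z‖ ≤ ‖f z - f 0 - z * deriv f 0‖ + ‖f 0‖ + ‖z * deriv f 0‖ := by
    calc ‖f z‖ = ‖(f z - f 0 - z * deriv f 0) + f 0 + z * deriv f 0‖ := by congr 1; ring
      _ ≤ _ := norm_add₃_le
  rw [norm_def]
  linarith [norm_nonneg (f 0), norm_nonneg (deriv f 0)]

end BesovB1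

/-! ### The Volterra transform as a primitive of `f g'`. -/

theorem integral_segment_eq_sub {P u : ℂ → ℂ} (hP : ∀ z ∈ unitDisc, HasDerivAt P (u z) z)
    (hu : ContinuousOn u unitDisc) {z : ℂ} (hz : z ∈ unitDisc) :
    ∫ t in (0 : ℝ)..1, u (t * z) * z = P z - P 0 := by
  have hm : ∀ t ∈ Set.Icc (0 : ℝ) 1, (t : ℂ) * z ∈ unitDisc := fun t ht => by
    rw [mem_ball_zero_iff] at hz ⊢
    rw [norm_mul, Complex.norm_real, Real.norm_of_nonneg ht.1]
    nlinarith [norm_nonneg z, ht.2]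
  have key := intervalIntegral.integral_eq_sub_of_hasDerivAt (a := 0) (b := 1)
    (f := fun t : ℝ => P (t * z)) (f' := fun t : ℝ => u (t * z) * z) ?_ ?_
  · simpa using key
  · intro t ht
    rw [Set.uIcc_of_le zero_le_one] at ht
    have h1 : HasDerivAt (fun t : ℝ => (t : ℂ) * z) z t := by
      simpa using ((hasDerivAt_id (t : ℂ)).mul_const z).comp_ofReal
    exact (hP _ (hm t ht)).comp t h1
  · refine ContinuousOn.intervalIntegrable ?_
    rw [Set.uIcc_of_le zero_le_one]
    have : ContinuousOn (fun t : ℝ => u (t * z)) (Set.Icc 0 1) :=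
      hu.comp (by fun_prop) hm
    exact this.mul continuousOn_const

theorem volterra_zero (g f : ℂ → ℂ) : volterra g f 0 = 0 := by simp [volterra]

/-- The analytic function `f g'` has a primitive `P` on the disc, and the segment integral equals `P
- P 0` there. -/
theorem hasDerivAt_volterra {g f : ℂ → ℂ} (hg : DifferentiableOn ℂ g unitDisc)
    (hf : DifferentiableOn ℂ f unitDisc) {z : ℂ} (hz : z ∈ unitDisc) :
    HasDerivAt (volterra g f) (f z * deriv g z) z := by
  have hu : DifferentiableOn ℂ (fun w => f w * deriv g w) unitDisc := hf.mul (hg.deriv isOpen_ball)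
  obtain ⟨P, hP⟩ := hu.isExactOn_ball
  refine ((hP z hz).sub_const (P 0)).congr_of_eventuallyEq ?_
  filter_upwards [isOpen_ball.mem_nhds hz] with w hw
  exact integral_segment_eq_sub hP hu.continuousOn hw

/-- Analytic functions on the disc with the same derivative and the same value at `0` agree. -/
theorem eqOn_unitDisc_of_deriv_eq {u v u' : ℂ → ℂ} (hu : ∀ z ∈ unitDisc, HasDerivAt u (u' z) z)
    (hv : ∀ z ∈ unitDisc, HasDerivAt v (u' z) z) (h0 : u 0 = v 0) : Set.EqOn u v unitDisc := by
  intro z hz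
  have hd : ∀ w ∈ unitDisc, HasDerivAt (fun x => u x - v x) 0 w := fun w hw =>
    ((hu w hw).sub (hv w hw)).congr_deriv (sub_self _)
  have := isOpen_ball.is_const_of_deriv_eq_zero (convex_ball (0 : ℂ) 1).isPreconnected
    (fun w hw => (hd w hw).differentiableAt.differentiableWithinAt)
    (fun w hw => (hd w hw).deriv) hz (by simp : (0 : ℂ) ∈ unitDisc)
  simp only [h0, sub_self] at this
  exact sub_eq_zero.1 this

theorem deriv_eqOn_unitDisc {u v : ℂ → ℂ} (h : Set.EqOn u v unitDisc) :
    Set.EqOn (deriv u) (deriv v) unitDisc := fun _ hz =>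
  (h.eventuallyEq_of_mem (isOpen_ball.mem_nhds hz)).deriv_eq

theorem deriv_mul_eqOn_unitDisc {u v : ℂ → ℂ} (hu : DifferentiableOn ℂ u unitDisc)
    (hv : DifferentiableOn ℂ v unitDisc) :
    Set.EqOn (deriv fun z => u z * v z) (fun z => deriv u z * v z + u z * deriv v z) unitDisc :=
  fun _ hz => deriv_fun_mul (hu.differentiableAt (isOpen_ball.mem_nhds hz))
    (hv.differentiableAt (isOpen_ball.mem_nhds hz))

theorem aestronglyMeasurable_of_differentiableOn {u : ℂ → ℂ} (hu : DifferentiableOn ℂ u unitDisc) :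
    AEStronglyMeasurable u areaMeasure :=
  (hu.continuousOn.aestronglyMeasurable measurableSet_ball).smul_measure _

/-! ### Constructing and comparing elements of `B₁`. -/

namespace BesovB1

@[ext]
theorem ext_unitDisc {f h : BesovB1} (H : ∀ z ∈ unitDisc, f z = h z) : f = h := by
  refine Subtype.ext (funext fun z => ?_)
  by_cases hz : z ∈ unitDisc
  · exact H z hz
  · exact (f.eq_zero_off hz).trans (h.eq_zero_off hz).symm

/-- The element of `B₁` given by an analytic function on the disc with integrable second
derivative. -/
noncomputable def mk (u : ℂ → ℂ) (hu : DifferentiableOn ℂ u unitDisc)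
    (hi : Integrable (deriv (deriv u)) areaMeasure) : BesovB1 :=
  ⟨unitDisc.indicator u, hu.congr fun _ hz => Set.indicator_of_mem hz u,
    fun _ hz => Set.indicator_of_notMem hz u, hi.congr (by
      filter_upwards [ae_areaMeasure_mem] with z hz
      exact (deriv_eqOn_unitDisc (deriv_eqOn_unitDisc Set.eqOn_indicator) hz).symm)⟩

theorem eqOn_mk {u : ℂ → ℂ} (hu : DifferentiableOn ℂ u unitDisc)
    (hi : Integrable (deriv (deriv u)) areaMeasure) : Set.EqOn (mk u hu hi) u unitDisc :=
  Set.eqOn_indicator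

theorem norm_mk {u : ℂ → ℂ} (hu : DifferentiableOn ℂ u unitDisc)
    (hi : Integrable (deriv (deriv u)) areaMeasure) :
    ‖mk u hu hi‖ = ‖u 0‖ + ‖deriv u 0‖ + ∫ z, ‖deriv (deriv u) z‖ ∂areaMeasure := by
  have h0 : (0 : ℂ) ∈ unitDisc := by simp
  have h := eqOn_mk hu hi
  rw [norm_def, h h0, deriv_eqOn_unitDisc h h0]
  congr 1
  refine integral_congr_ae ?_
  filter_upwards [ae_areaMeasure_mem] with z hz
  rw [deriv_eqOn_unitDisc (deriv_eqOn_unitDisc h) hz]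

theorem hasDerivAt (f : BesovB1) {z : ℂ} (hz : z ∈ unitDisc) : HasDerivAt f (deriv f z) z :=
  (f.differentiableOn.differentiableAt (isOpen_ball.mem_nhds hz)).hasDerivAt

/-- The constant function `1`. -/
noncomputable def const_one : BesovB1 :=
  mk (fun _ => 1) (differentiableOn_const 1) (by simp [deriv_const'])

theorem const_one_apply {z : ℂ} (hz : z ∈ unitDisc) : const_one z = 1 := eqOn_mk _ _ hz

end BesovB1

/-! ### What boundedness of the operator says about its symbol. -/

namespace IsVolterraOperator

variable {g : ℂ → ℂ} {T : BesovB1 →L[ℂ] BesovB1}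

theorem apply_zero (hT : IsVolterraOperator g T) (f : BesovB1) : T f 0 = 0 := by
  rw [hT f 0 (by simp), volterra_zero]

theorem hasDerivAt (hT : IsVolterraOperator g T) (hg : DifferentiableOn ℂ g unitDisc)
    (f : BesovB1) {z : ℂ} (hz : z ∈ unitDisc) : HasDerivAt (T f) (f z * deriv g z) z := by
  refine (hasDerivAt_volterra hg f.differentiableOn hz).congr_of_eventuallyEq ?_
  filter_upwards [isOpen_ball.mem_nhds hz] with w hw using hT f w hw

theorem deriv_deriv (hT : IsVolterraOperator g T) (hg : DifferentiableOn ℂ g unitDisc)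
    (f : BesovB1) {z : ℂ} (hz : z ∈ unitDisc) :
    deriv (deriv (T f)) z = deriv f z * deriv g z + f z * deriv (deriv g) z := by
  have h : Set.EqOn (deriv (T f)) (fun z => f z * deriv g z) unitDisc :=
    fun w hw => (hT.hasDerivAt hg f hw).deriv
  rw [deriv_eqOn_unitDisc h hz]
  exact deriv_mul_eqOn_unitDisc f.differentiableOn (hg.deriv isOpen_ball) hz

theorem apply_const_one (hT : IsVolterraOperator g T) (hg : DifferentiableOn ℂ g unitDisc) :
    Set.EqOn (T BesovB1.const_one) (fun z => g z - g 0) unitDisc := by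
  refine eqOn_unitDisc_of_deriv_eq (u' := deriv g) (fun z hz => ?_) (fun z hz => ?_) ?_
  · simpa [BesovB1.const_one_apply hz] using hT.hasDerivAt hg BesovB1.const_one hz
  · exact ((hg.differentiableAt (isOpen_ball.mem_nhds hz)).hasDerivAt).sub_const _
  · simp [hT.apply_zero]

theorem deriv_apply_const_one (hT : IsVolterraOperator g T)
    (hg : DifferentiableOn ℂ g unitDisc) :
    Set.EqOn (deriv (T BesovB1.const_one)) (deriv g) unitDisc := fun z hz => by
  rw [deriv_eqOn_unitDisc (hT.apply_const_one hg) hz, deriv_sub_const]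

theorem norm_symbol_le (hT : IsVolterraOperator g T) (hg : DifferentiableOn ℂ g unitDisc) {z : ℂ}
    (hz : z ∈ unitDisc) : ‖g z‖ ≤ 2 * ‖T BesovB1.const_one‖ + ‖g 0‖ := by
  have h1 := (T BesovB1.const_one).norm_apply_le hz
  rw [hT.apply_const_one hg hz] at h1
  have := norm_add_le (g z - g 0) (g 0)
  rw [sub_add_cancel] at this
  linarith

theorem integrable_deriv_deriv_symbol (hT : IsVolterraOperator g T)
    (hg : DifferentiableOn ℂ g unitDisc) : Integrable (deriv (deriv g)) areaMeasure := by
  refine (T BesovB1.const_one).integrable.congr ?_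
  filter_upwards [ae_areaMeasure_mem] with z hz
  exact deriv_eqOn_unitDisc (hT.deriv_apply_const_one hg) hz

/-- Write `f' g' = (T f)'' - f g''`: the first term is integrable because `T f` lies in `B₁`, the
second because `f` is bounded by `2 ‖f‖` and `g''` is integrable. -/
theorem integrable_deriv_mul_deriv_symbol (hT : IsVolterraOperator g T)
    (hg : DifferentiableOn ℂ g unitDisc) (f : BesovB1) :
    Integrable (fun z => deriv f z * deriv g z) areaMeasure ∧
    ∫ z, ‖deriv f z * deriv g z‖ ∂areaMeasure ≤
      (‖T‖ + 2 * ∫ z, ‖deriv (deriv g) z‖ ∂areaMeasure) * ‖f‖ := by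
  have hgi := hT.integrable_deriv_deriv_symbol hg
  have hdom : Integrable (fun z => ‖deriv (deriv (T f)) z‖ + 2 * ‖f‖ * ‖deriv (deriv g) z‖)
      areaMeasure := (T f).integrable.norm.add (hgi.norm.const_mul _)
  have hle : ∀ᵐ z ∂areaMeasure, ‖deriv f z * deriv g z‖ ≤
      ‖deriv (deriv (T f)) z‖ + 2 * ‖f‖ * ‖deriv (deriv g) z‖ := by
    filter_upwards [ae_areaMeasure_mem] with z hz
    have e : deriv f z * deriv g z = deriv (deriv (T f)) z - f z * deriv (deriv g) z := by
      rw [hT.deriv_deriv hg f hz]; ring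
    rw [e]
    refine (norm_sub_le _ _).trans ?_
    rw [norm_mul]
    gcongr
    exact f.norm_apply_le hz
  have hi : Integrable (fun z => deriv f z * deriv g z) areaMeasure :=
    hdom.mono' (aestronglyMeasurable_of_differentiableOn
      ((f.differentiableOn.deriv isOpen_ball).mul (hg.deriv isOpen_ball))) hle
  refine ⟨hi, (integral_mono_ae hi.norm hdom hle).trans ?_⟩
  rw [integral_add (T f).integrable.norm (hgi.norm.const_mul _), integral_const_mul]
  have := ((T f).integral_norm_deriv_deriv_le).trans (T.le_opNorm f)
  nlinarith

/-- Apply the previous estimate to `f = T 1`, whose derivative is `g'`. -/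
theorem integrable_deriv_symbol_sq (hT : IsVolterraOperator g T)
    (hg : DifferentiableOn ℂ g unitDisc) :
    Integrable (fun z => deriv g z ^ 2) areaMeasure := by
  refine (hT.integrable_deriv_mul_deriv_symbol hg (T BesovB1.const_one)).1.congr ?_
  filter_upwards [ae_areaMeasure_mem] with z hz
  rw [hT.deriv_apply_const_one hg hz, sq]

end IsVolterraOperator

/-! ### Multiplication by `exp (c g)`. -/

theorem deriv_deriv_cexp_mul {g f : ℂ → ℂ} (hg : DifferentiableOn ℂ g unitDisc)
    (hf : DifferentiableOn ℂ f unitDisc) (c : ℂ) {z : ℂ} (hz : z ∈ unitDisc) :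
    deriv (fun w => Complex.exp (c * g w) * f w) z =
      Complex.exp (c * g z) * (c * deriv g z * f z + deriv f z) ∧
    deriv (deriv fun w => Complex.exp (c * g w) * f w) z =
      Complex.exp (c * g z) * ((c ^ 2 * deriv g z ^ 2 + c * deriv (deriv g) z) * f z +
        2 * c * (deriv f z * deriv g z) + deriv (deriv f) z) := by
  have hd : ∀ {u : ℂ → ℂ}, DifferentiableOn ℂ u unitDisc → ∀ w ∈ unitDisc,
      HasDerivAt u (deriv u w) w := fun hu w hw =>
    (hu.differentiableAt (isOpen_ball.mem_nhds hw)).hasDerivAt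
  have hE : ∀ w ∈ unitDisc, HasDerivAt (fun w => Complex.exp (c * g w))
      (Complex.exp (c * g w) * (c * deriv g w)) w := fun w hw =>
    ((hd hg w hw).const_mul c).cexp
  have h1 : ∀ w ∈ unitDisc, HasDerivAt (fun w => Complex.exp (c * g w) * f w)
      (Complex.exp (c * g w) * (c * deriv g w * f w + deriv f w)) w := fun w hw =>
    ((hE w hw).mul (hd hf w hw)).congr_deriv (by ring)
  refine ⟨(h1 z hz).deriv, ?_⟩
  have h2 : Set.EqOn (deriv fun w => Complex.exp (c * g w) * f w)
      (fun w => Complex.exp (c * g w) * (c * deriv g w * f w + deriv f w)) unitDisc :=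
    fun w hw => (h1 w hw).deriv
  rw [deriv_eqOn_unitDisc h2 hz]
  have hg1 := hd (hg.deriv isOpen_ball) z hz
  have hf1 := hd (hf.deriv isOpen_ball) z hz
  refine HasDerivAt.deriv (((hE z hz).mul
    (((hg1.const_mul c).mul (hd hf z hz)).add hf1)).congr_deriv ?_)
  simp only [Pi.add_apply, Pi.mul_apply]
  ring

namespace IsVolterraOperator

variable {g : ℂ → ℂ} {T : BesovB1 →L[ℂ] BesovB1}

theorem norm_cexp_symbol_le (hT : IsVolterraOperator g T) (hg : DifferentiableOn ℂ g unitDisc)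
    (c : ℂ) {z : ℂ} (hz : z ∈ unitDisc) :
    ‖Complex.exp (c * g z)‖ ≤ Real.exp (‖c‖ * (2 * ‖T BesovB1.const_one‖ + ‖g 0‖)) := by
  refine (Complex.norm_exp_le_exp_norm _).trans (Real.exp_le_exp.2 ?_)
  rw [norm_mul]
  gcongr
  exact hT.norm_symbol_le hg hz

theorem cexp_mul_estimate (hT : IsVolterraOperator g T) (hg : DifferentiableOn ℂ g unitDisc)
    (c : ℂ) : ∃ C : ℝ, ∀ f : BesovB1,
      Integrable (deriv (deriv fun z => Complex.exp (c * g z) * f z)) areaMeasure ∧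
      ∫ z, ‖deriv (deriv fun z => Complex.exp (c * g z) * f z) z‖ ∂areaMeasure ≤ C * ‖f‖ := by
  set B := Real.exp (‖c‖ * (2 * ‖T BesovB1.const_one‖ + ‖g 0‖)) with hB
  set A := ‖T‖ + 2 * ∫ z, ‖deriv (deriv g) z‖ ∂areaMeasure with hA
  set S := ∫ z, ‖deriv g z ^ 2‖ ∂areaMeasure
  set D := ∫ z, ‖deriv (deriv g) z‖ ∂areaMeasure
  have hB0 : 0 ≤ B := (Real.exp_pos _).le
  -- `B` bounds `exp (c g)`; the four summands come from `c² g'² f`, `c g'' f`, `2 c f' g'` and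
  -- `f''`. In the first two the `2` is the embedding constant.
  refine ⟨B * (2 * ‖c‖ ^ 2 * S + 2 * ‖c‖ * D + 2 * ‖c‖ * A + 1), fun f => ?_⟩
  have hgi := (hT.integrable_deriv_deriv_symbol hg).norm
  have hgs := (hT.integrable_deriv_symbol_sq hg).norm
  obtain ⟨hfg, hfgle⟩ := hT.integrable_deriv_mul_deriv_symbol hg f
  have hi1 := hgs.const_mul (2 * ‖f‖ * ‖c‖ ^ 2)
  have hi2 := hgi.const_mul (2 * ‖f‖ * ‖c‖)
  have hi3 := hfg.norm.const_mul (2 * ‖c‖)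
  have hi4 := f.integrable.norm
  have hdom := (((hi1.add hi2).add hi3).add hi4).const_mul B
  have hle : ∀ᵐ z ∂areaMeasure, ‖deriv (deriv fun z => Complex.exp (c * g z) * f z) z‖ ≤
      B * (2 * ‖f‖ * ‖c‖ ^ 2 * ‖deriv g z ^ 2‖ + 2 * ‖f‖ * ‖c‖ * ‖deriv (deriv g) z‖ +
        2 * ‖c‖ * ‖deriv f z * deriv g z‖ + ‖deriv (deriv f) z‖) := by
    filter_upwards [ae_areaMeasure_mem] with z hz
    rw [(deriv_deriv_cexp_mul hg f.differentiableOn c hz).2, norm_mul]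
    refine mul_le_mul (hT.norm_cexp_symbol_le hg c hz) ?_ (norm_nonneg _) hB0
    refine norm_add₃_le.trans ?_
    have e1 : ‖(c ^ 2 * deriv g z ^ 2 + c * deriv (deriv g) z) * f z‖ ≤
        (‖c‖ ^ 2 * ‖deriv g z ^ 2‖ + ‖c‖ * ‖deriv (deriv g) z‖) * (2 * ‖f‖) := by
      rw [norm_mul]
      refine mul_le_mul ?_ (f.norm_apply_le hz) (norm_nonneg _) (by positivity)
      refine (norm_add_le _ _).trans (le_of_eq ?_)
      rw [norm_mul, norm_mul, norm_pow c]
    have e2 : ‖2 * c * (deriv f z * deriv g z)‖ = 2 * ‖c‖ * ‖deriv f z * deriv g z‖ := by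
      rw [norm_mul, norm_mul, Complex.norm_ofNat]
    rw [e2]
    linarith
  have hE : DifferentiableOn ℂ (fun z => Complex.exp (c * g z) * f z) unitDisc :=
    (hg.const_mul c).cexp.mul f.differentiableOn
  have hi := hdom.mono' (aestronglyMeasurable_of_differentiableOn
    ((hE.deriv isOpen_ball).deriv isOpen_ball)) hle
  refine ⟨hi, (integral_mono_ae hi.norm hdom hle).trans ?_⟩
  rw [integral_const_mul, integral_add' ((hi1.add hi2).add hi3) hi4,
    integral_add' (hi1.add hi2) hi3, integral_add' hi1 hi2, integral_const_mul,
    integral_const_mul, integral_const_mul, mul_assoc B]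
  refine mul_le_mul_of_nonneg_left ?_ hB0
  have h4 := f.integral_norm_deriv_deriv_le
  have h3 := mul_le_mul_of_nonneg_left hfgle (by positivity : 0 ≤ 2 * ‖c‖)
  linarith

/-- Multiplication by `exp (c g)` is bounded on `B₁`. -/
theorem exists_cexp_multiplier (hT : IsVolterraOperator g T) (hg : DifferentiableOn ℂ g unitDisc)
    (c : ℂ) : ∃ M : BesovB1 →L[ℂ] BesovB1, ∀ f : BesovB1, ∀ z ∈ unitDisc,
      M f z = Complex.exp (c * g z) * f z := by
  obtain ⟨C, hC⟩ := hT.cexp_mul_estimate hg c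
  have hE : ∀ f : BesovB1, DifferentiableOn ℂ (fun z => Complex.exp (c * g z) * f z) unitDisc :=
    fun f => (hg.const_mul c).cexp.mul f.differentiableOn
  let M : BesovB1 →ₗ[ℂ] BesovB1 :=
    { toFun := fun f => BesovB1.mk _ (hE f) (hC f).1
      map_add' := fun f h => by
        refine BesovB1.ext_unitDisc fun z hz => ?_
        simp only [BesovB1.coe_add, Pi.add_apply, BesovB1.eqOn_mk _ _ hz]
        ring
      map_smul' := fun a f => by
        refine BesovB1.ext_unitDisc fun z hz => ?_
        simp only [BesovB1.coe_smul, Pi.smul_apply, BesovB1.eqOn_mk _ _ hz, RingHom.id_apply,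
          smul_eq_mul]
        ring }
  -- The three summands bound the three parts of the norm: value at `0`, derivative at `0`,
  -- integral.
  refine ⟨M.mkContinuous (‖Complex.exp (c * g 0)‖ + ‖Complex.exp (c * g 0)‖ *
    (‖c * deriv g 0‖ + 1) + C) fun f => ?_, fun f z hz => BesovB1.eqOn_mk (hE f) (hC f).1 hz⟩
  have h0 : (0 : ℂ) ∈ unitDisc := by simp
  have e := (BesovB1.norm_mk (hE f) (hC f).1)
  rw [(deriv_deriv_cexp_mul hg f.differentiableOn c h0).1] at e
  have h1 : ‖Complex.exp (c * g 0) * f 0‖ ≤ ‖Complex.exp (c * g 0)‖ * ‖f‖ := by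
    rw [norm_mul]; gcongr; exact f.norm_apply_zero_le
  have h2 : ‖Complex.exp (c * g 0) * (c * deriv g 0 * f 0 + deriv f 0)‖ ≤
      ‖Complex.exp (c * g 0)‖ * ((‖c * deriv g 0‖ + 1) * ‖f‖) := by
    rw [norm_mul]
    gcongr
    refine (norm_add_le _ _).trans ?_
    rw [norm_mul (c * deriv g 0)]
    nlinarith [f.norm_apply_zero_le, f.norm_deriv_zero_le, norm_nonneg (c * deriv g 0)]
  have h3 := (hC f).2
  change ‖BesovB1.mk _ (hE f) (hC f).1‖ ≤ _
  rw [e]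
  linarith

/-! ### The resolvent and the spectrum. -/

/-- For `l ≠ 0` the resolvent of a bounded Volterra operator is
`l⁻¹ + l⁻² exp (g / l) T exp (-g / l)`. -/
theorem isUnit_sub (hT : IsVolterraOperator g T) (hg : DifferentiableOn ℂ g unitDisc)
    {l : ℂ} (hl : l ≠ 0) : IsUnit (algebraMap ℂ (BesovB1 →L[ℂ] BesovB1) l - T) := by
  obtain ⟨P, hP⟩ := hT.exists_cexp_multiplier hg l⁻¹
  obtain ⟨N, hN⟩ := hT.exists_cexp_multiplier hg (-l⁻¹)
  have h0 : (0 : ℂ) ∈ unitDisc := by simp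
  have hexp : ∀ z, Complex.exp (l⁻¹ * g z) * Complex.exp (-l⁻¹ * g z) = 1 := fun z => by
    rw [← Complex.exp_add, ← Complex.exp_zero]; congr 1; ring
  have hd : ∀ c, ∀ z ∈ unitDisc, HasDerivAt (fun w => Complex.exp (c * g w))
      (Complex.exp (c * g z) * (c * deriv g z)) z := fun c z hz =>
    (((hg.differentiableAt (isOpen_ball.mem_nhds hz)).hasDerivAt).const_mul c).cexp
  have hsub : ∀ f : BesovB1, ∀ z, (algebraMap ℂ (BesovB1 →L[ℂ] BesovB1) l - T) f z =
      l * f z - T f z := fun f z => by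
    have : (algebraMap ℂ (BesovB1 →L[ℂ] BesovB1) l - T) f = l • f + (-1 : ℂ) • T f := by
      rw [sub_apply, ContinuousLinearMap.algebraMap_apply]
      module
    rw [this, BesovB1.coe_add, BesovB1.coe_smul, BesovB1.coe_smul]
    simp [sub_eq_add_neg]
  let R : BesovB1 →L[ℂ] BesovB1 := l⁻¹ • 1 + (l⁻¹ ^ 2) • (P * T * N)
  have hR : ∀ f : BesovB1, ∀ z ∈ unitDisc, R f z =
      l⁻¹ * f z + l⁻¹ ^ 2 * (Complex.exp (l⁻¹ * g z) * T (N f) z) := fun f z hz => by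
    have : R f = l⁻¹ • f + (l⁻¹ ^ 2) • P (T (N f)) := rfl
    rw [this, BesovB1.coe_add, BesovB1.coe_smul, BesovB1.coe_smul]
    simp [hP _ z hz]
  have hTN : ∀ f : BesovB1, ∀ z ∈ unitDisc, HasDerivAt (T (N f))
      (Complex.exp (-l⁻¹ * g z) * f z * deriv g z) z := fun f z hz => by
    have := hT.hasDerivAt hg (N f) hz
    rwa [hN f z hz] at this
  refine isUnit_iff_exists.2 ⟨R, ?_, ?_⟩
  · refine ContinuousLinearMap.ext fun f => BesovB1.ext_unitDisc fun z hz => ?_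
    -- Both sides vanish at `0` and have derivative `g' R f`. Hence `T R f` cancels the second term
    -- of `l R f`.
    have key : Set.EqOn (T (R f)) (fun z => l⁻¹ * (Complex.exp (l⁻¹ * g z) * T (N f) z))
        unitDisc := by
      refine eqOn_unitDisc_of_deriv_eq (fun w hw => hT.hasDerivAt hg (R f) hw)
        (fun w hw => (((hd l⁻¹ w hw).mul (hTN f w hw)).const_mul l⁻¹).congr_deriv ?_) ?_
      · rw [hR f w hw]
        linear_combination (l⁻¹ * f w * deriv g w) * hexp w
      · simp [hT.apply_zero]
    change (algebraMap ℂ (BesovB1 →L[ℂ] BesovB1) l - T) (R f) z = f z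
    rw [hsub, key hz, hR f z hz]
    field_simp
    ring
  · refine ContinuousLinearMap.ext fun f => BesovB1.ext_unitDisc fun z hz => ?_
    set h := (algebraMap ℂ (BesovB1 →L[ℂ] BesovB1) l - T) f with hh
    -- Both sides vanish at `0` and have derivative `exp (-g / l) g' (l f - T f)`, so the
    -- exponentials in `R h` cancel.
    have key : Set.EqOn (T (N h)) (fun z => l * (Complex.exp (-l⁻¹ * g z) * T f z)) unitDisc := by
      refine eqOn_unitDisc_of_deriv_eq (fun w hw => hTN h w hw)
        (fun w hw => (((hd (-l⁻¹) w hw).mul (hT.hasDerivAt hg f hw)).const_mul l).congr_deriv ?_) ?_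
      · rw [hsub f w]
        field_simp
        ring
      · simp [hT.apply_zero]
    change R h z = f z
    rw [hR h z hz, key hz, hsub f z]
    have := hexp z
    have e : l⁻¹ ^ 2 * (Complex.exp (l⁻¹ * g z) * (l * (Complex.exp (-l⁻¹ * g z) * T f z))) =
        l⁻¹ ^ 2 * l * (Complex.exp (l⁻¹ * g z) * Complex.exp (-l⁻¹ * g z)) * T f z := by ring
    rw [e, this]
    field_simp
    ring

/-- The constant `1` is not in the range, since every function in the range vanishes at `0`. -/
theorem not_isUnit (hT : IsVolterraOperator g T) : ¬ IsUnit T := by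
  intro h
  obtain ⟨S, hS, -⟩ := isUnit_iff_exists.1 h
  have h1 : T (S BesovB1.const_one) = BesovB1.const_one := DFunLike.congr_fun hS _
  have h2 := hT.apply_zero (S BesovB1.const_one)
  rw [h1, BesovB1.const_one_apply (by simp)] at h2
  exact one_ne_zero h2

end IsVolterraOperator

theorem theorem13 (g : ℂ → ℂ) (hg : DifferentiableOn ℂ g unitDisc)
    (T : BesovB1 →L[ℂ] BesovB1) (hT : IsVolterraOperator g T) :
    spectrum ℂ T = {0} := by
  ext l
  rw [spectrum.mem_iff, Set.mem_singleton_iff]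
  refine ⟨fun h => by_contra fun hl => h (hT.isUnit_sub hg hl), ?_⟩
  rintro rfl
  rw [map_zero, zero_sub, IsUnit.neg_iff]
  exact hT.not_isUnit
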